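/- An overpartition of a non-negative integer $m$ is a partition of $m$ in which the first occurrence of each part size may be overlined. Let $\overline{p}_o(m)$ denote the number of overpartitions of $m$ all of whose parts are odd. Then for all integers $n \geq 0$ and $\alpha \geq 0$, $$\overline{p}_o\bigl(2^{2\alpha}(24n+9)\bigr) \equiv 0 \pmod 3 \qquad\text{and}\qquad \overline{p}_o\bigl(2^{2\alpha}(24n+15)\bigr) \equiv 0 \pmod 3.$$ -/

import Mathlib

/-- An overpartition of `n`: a partition of `n` in which the first occurrence of each part size
may be overlined, so the overlining is the choice of a set of part sizes that occur. -/
@[ext]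
structure Overpartition (n : ℕ) where
  /-- the underlying partition of `n` -/
  partition : n.Partition
  /-- the part sizes whose first occurrence is overlined -/
  overlined : Finset ℕ
  /-- only sizes that occur as parts can be overlined -/
  overlined_subset : overlined ⊆ partition.parts.toFinset

/-- There are only finitely many overpartitions of `n`. -/
instance Overpartition.instFinite (n : ℕ) : Finite (Overpartition n) := by
  refine Finite.of_injective
    (fun P : Overpartition n =>
      (⟨P.partition, ⟨P.overlined, Finset.mem_powerset.2 P.overlined_subset⟩⟩ :
        Σ p : n.Partition, {s : Finset ℕ // s ∈ p.parts.toFinset.powerset})) ?_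
  rintro ⟨p, s, hs⟩ ⟨p', s', hs'⟩ h
  simp only [Sigma.mk.injEq] at h
  obtain ⟨rfl, h⟩ := h
  have h2 : s = s' := congrArg Subtype.val (eq_of_heq h)
  subst h2
  rfl

/-- The number of overpartitions of `n` into odd parts. -/
noncomputable def overpartitionOdd (n : ℕ) : ℕ :=
  Nat.card {P : Overpartition n // ∀ i ∈ P.partition.parts, Odd i}

/-! ### Generating function and its Euler product -/

open PowerSeries

/-! Let `P` be the generating series, `φ(q) = ∑ q^(x²)` over the integers, `a = φ(q)` and `b =
φ(-q)`. The Euler product of `P` and the Jacobi triple product give `P² b = a`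
(`overpartitionOddSeries_sq_mul_theta`); with `a b = φ(-q²)²` (`theta_mul_theta_neg`) this yields `P
a b² = φ(-q²)³`.

Modulo 3, `P = (P/a)³ a² b`, and a cube is a series in `q³`, so extracting the exponents divisible
by 3 only concerns `a² b`. Squares are 0 or 1 mod 3, and `a⁹ = φ(q⁹)` collects the class 0 of `a`;
hence the wanted part of `a² b` is `a¹⁸ b⁹ + (a - a⁹)² (b - b⁹)`. The relation `a⁴ + b⁴ = -1`
(`theta_pow_four_add`) collapses it to `a⁶ b⁹`. Taking cube roots, the counts at `3m` have
generating series `P a b³ = φ(-q) φ(-q⁶)` mod 3 (`overpartitionOdd_three_mul`), so they vanish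
unless `m = x² + 6y²`. Residues mod 8 and descent by 4 rule this form out for `4^α (8n+3)` and `4^α
(8n+5)`. -/

theorem overpartitionOdd_eq_sum (n : ℕ) :
    overpartitionOdd n = ∑ p : n.Partition, p.parts.toFinsupp.prod
      fun i _ => if Odd i then 2 else 0 := by
  classical
  let e : {P : Overpartition n // ∀ i ∈ P.partition.parts, Odd i} ≃
      Σ p : {p : n.Partition // ∀ i ∈ p.parts, Odd i}, (p.1.parts.toFinset.powerset : Finset _) :=
    { toFun := fun P => ⟨⟨P.1.partition, P.2⟩, ⟨P.1.overlined,
        Finset.mem_powerset.2 P.1.overlined_subset⟩⟩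
      invFun := fun x => ⟨⟨x.1.1, x.2.1, Finset.mem_powerset.1 x.2.2⟩, x.1.2⟩
      left_inv := fun _ => rfl
      right_inv := fun _ => rfl }
  rw [overpartitionOdd, Nat.card_congr e, Nat.card_sigma]
  simp only [Nat.card_eq_fintype_card, Fintype.card_coe, Finset.card_powerset]
  rw [← Finset.sum_subtype (Finset.univ.filter fun p : n.Partition => ∀ i ∈ p.parts, Odd i)
    (by simp) (fun p : n.Partition => 2 ^ p.parts.toFinset.card), Finset.sum_filter]
  refine Finset.sum_congr rfl fun p _ => ?_
  simp only [Finsupp.prod, Multiset.toFinsupp_support]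
  split_ifs with h
  · rw [Finset.prod_congr rfl (g := fun _ => 2) fun i hi => if_pos (h i (by simpa using hi))]
    simp
  · push Not at h
    obtain ⟨i, hi, hodd⟩ := h
    exact (Finset.prod_eq_zero (i := i) (by simpa using hi) (if_neg hodd)).symm

/-- The generating function of overpartitions into odd parts. -/
noncomputable def overpartitionOddSeries (R : Type*) [CommRing R] : R⟦X⟧ :=
  mk fun n => (overpartitionOdd n : R)

theorem overpartitionOddSeries_eq_genFun (R : Type*) [CommRing R] :
    overpartitionOddSeries R = Nat.Partition.genFun fun i _ => if Odd i then (2 : R) else 0 := by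
  ext n
  rw [overpartitionOddSeries, coeff_mk, Nat.Partition.coeff_genFun, overpartitionOdd_eq_sum]
  simp [Finsupp.prod]

theorem constantCoeff_overpartitionOddSeries (R : Type*) [CommRing R] :
    constantCoeff (overpartitionOddSeries R) = 1 := by
  rw [overpartitionOddSeries_eq_genFun, ← coeff_zero_eq_constantCoeff_apply,
    Nat.Partition.coeff_genFun]
  simp

section Product

open scoped PowerSeries.WithPiTopology

theorem one_add_tsum_mul_one_sub {R : Type*} [CommRing R] [TopologicalSpace R]
    [IsTopologicalRing R] [T2Space R] (i : ℕ) (c : R) :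
    (1 + ∑' j : ℕ, c • (X : R⟦X⟧) ^ ((i + 1) * (j + 1))) * (1 - X ^ (i + 1))
      = 1 - X ^ (i + 1) + c • X ^ (i + 1) := by
  have h0 : constantCoeff ((X : R⟦X⟧) ^ (i + 1)) = 0 := by simp
  have h1 := WithPiTopology.summable_pow_of_constantCoeff_eq_zero h0
  have h2 := WithPiTopology.tsum_pow_mul_one_sub_of_constantCoeff_eq_zero h0
  have h3 : ∑' j : ℕ, c • (X : R⟦X⟧) ^ ((i + 1) * (j + 1))
      = (c • X ^ (i + 1)) * ∑' j : ℕ, ((X : R⟦X⟧) ^ (i + 1)) ^ j := by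
    rw [← h1.tsum_mul_left]
    refine tsum_congr fun j => ?_
    rw [smul_mul_assoc, ← pow_succ', ← pow_mul]
  rw [h3, add_mul, mul_assoc, h2]
  ring

/-- Truncated product formula for the generating function of overpartitions into odd parts. -/
theorem X_pow_dvd_overpartitionOddSeries_mul_sub (R : Type*) [CommRing R] (N : ℕ) :
    ∃ n₀, ∀ n ≥ n₀, (X : R⟦X⟧) ^ N ∣ overpartitionOddSeries R *
      ∏ k ∈ Finset.range n, (1 - X ^ (2 * k + 1)) - ∏ k ∈ Finset.range n, (1 + X ^ (2 * k + 1)) := by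
  -- In the discrete topology, convergence means that each coefficient is eventually constant.
  let _ : TopologicalSpace R := ⊥
  have : DiscreteTopology R := ⟨rfl⟩
  set t : ℕ → R⟦X⟧ := fun i =>
    1 + ∑' j : ℕ, (if Odd (i + 1) then (2 : R) else 0) • (X : R⟦X⟧) ^ ((i + 1) * (j + 1)) with ht
  have hprod : HasProd t (overpartitionOddSeries R) := by
    rw [overpartitionOddSeries_eq_genFun]
    exact Nat.Partition.hasProd_genFun fun i _ => if Odd i then (2 : R) else 0
  have hlim := hprod.tendsto_prod_nat
  rw [WithPiTopology.tendsto_iff_coeff_tendsto] at hlim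
  have hev : ∀ᶠ M in Filter.atTop, ∀ d < N,
      coeff d (∏ i ∈ Finset.range M, t i) = coeff d (overpartitionOddSeries R) := by
    refine (Filter.eventually_all_finite (Set.finite_Iio N)).2 fun d _ => ?_
    have := hlim d
    rw [nhds_discrete, Filter.tendsto_pure] at this
    exact this
  obtain ⟨M, hM⟩ := Filter.eventually_atTop.1 hev
  refine ⟨M, fun n hn => ?_⟩
  -- Index `i` stands for part size `i + 1`: even sizes contribute 1, odd ones `(1 + X^(i+1)) / (1 -
  -- X^(i+1))`.
  have hfin : (∏ i ∈ Finset.range (2 * n), t i) * ∏ k ∈ Finset.range n, (1 - X ^ (2 * k + 1))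
      = ∏ k ∈ Finset.range n, (1 + (X : R⟦X⟧) ^ (2 * k + 1)) := by
    clear hn
    induction n with
    | zero => simp
    | succ n ih =>
      have h1 : t (2 * n) * (1 - X ^ (2 * n + 1)) = 1 + X ^ (2 * n + 1) := by
        simp only [ht, if_pos (show Odd (2 * n + 1) from ⟨n, rfl⟩), one_add_tsum_mul_one_sub]
        rw [two_smul]
        ring
      have h2 : t (2 * n + 1) = 1 := by
        simp [ht, show ¬ Odd (2 * n + 1 + 1) by simp [Nat.odd_iff]; omega]
      rw [show 2 * (n + 1) = 2 * n + 1 + 1 by ring, Finset.prod_range_succ, Finset.prod_range_succ,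
        Finset.prod_range_succ, Finset.prod_range_succ, h2, ← ih, ← h1]
      ring
  rw [← hfin, ← sub_mul]
  refine dvd_mul_of_dvd_left (X_pow_dvd_iff.2 fun d hd => ?_) _
  rw [map_sub, hM (2 * n) (by omega) d hd, sub_self]

end Product

/-! ### Gaussian binomials and the Jacobi triple product -/

section Theta

variable {R : Type*} [CommRing R]

/-- Gaussian binomial coefficients in the variable `t`, by the Pascal recursion. -/
def gaussBinom (t : R) : ℕ → ℕ → R
  | _, 0 => 1
  | 0, _ + 1 => 0
  | N + 1, i + 1 => gaussBinom t N i + t ^ (i + 1) * gaussBinom t N (i + 1)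

@[simp]
theorem gaussBinom_zero_right (t : R) (N : ℕ) : gaussBinom t N 0 = 1 := by
  cases N <;> rfl

theorem gaussBinom_succ_succ (t : R) (N i : ℕ) : gaussBinom t (N + 1) (i + 1) =
    gaussBinom t N i + t ^ (i + 1) * gaussBinom t N (i + 1) := rfl

theorem gaussBinom_eq_zero_of_lt (t : R) {N i : ℕ} (h : N < i) : gaussBinom t N i = 0 := by
  induction N generalizing i with
  | zero => obtain ⟨i, rfl⟩ := Nat.exists_eq_succ_of_ne_zero h.ne'; rfl
  | succ N ih =>
    obtain ⟨i, rfl⟩ := Nat.exists_eq_succ_of_ne_zero (by omega : i ≠ 0)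
    rw [gaussBinom_succ_succ, ih (by omega), ih (by omega)]
    simp

theorem gaussBinom_self (t : R) (N : ℕ) : gaussBinom t N N = 1 := by
  induction N with
  | zero => rfl
  | succ N ih => rw [gaussBinom_succ_succ, ih, gaussBinom_eq_zero_of_lt t (by omega)]; simp

/-- Makes the central coefficient at `t = X ^ 2` a unit, so that it can later be cancelled. -/
theorem dvd_gaussBinom_sub_one (t : R) {N i : ℕ} (h : i ≤ N) : t ∣ gaussBinom t N i - 1 := by
  induction N generalizing i with
  | zero => obtain rfl := Nat.le_zero.1 h; simp
  | succ N ih =>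
    rcases i with _ | i
    · simp
    · rw [gaussBinom_succ_succ, add_sub_right_comm]
      exact dvd_add (ih (by omega)) (dvd_mul_of_dvd_left (dvd_pow_self t i.succ_ne_zero) _)

/-- The second Pascal recursion. -/
theorem gaussBinom_succ_succ' (t : R) (i j : ℕ) : gaussBinom t (i + j + 1) (i + 1) =
    t ^ j * gaussBinom t (i + j) i + gaussBinom t (i + j) (i + 1) := by
  induction h : i + j generalizing i j with
  | zero =>
    obtain ⟨rfl, rfl⟩ : i = 0 ∧ j = 0 := by omega
    simp [gaussBinom]
  | succ N ih =>
    rcases i with _ | i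
    · obtain rfl : j = N + 1 := by omega
      have := ih 0 N (by omega)
      simp only [gaussBinom_zero_right, gaussBinom_succ_succ, zero_add] at this ⊢
      linear_combination t * this
    · rcases j with _ | j
      · obtain rfl : i = N := by omega
        rw [gaussBinom_self, gaussBinom_self, gaussBinom_eq_zero_of_lt t (by omega)]
        simp
      · have h1 := ih i (j + 1) (by omega)
        have h2 := ih (i + 1) j (by omega)
        rw [gaussBinom_succ_succ t (N + 1), gaussBinom_succ_succ t N i,
          gaussBinom_succ_succ t N (i + 1)]
        rw [gaussBinom_succ_succ] at h1 h2
        linear_combination h1 + t ^ (i + 2) * h2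

/-- Rothe's identity, the `q`-binomial theorem. -/
theorem prod_add_mul_pow_eq_sum_gaussBinom (t x y : R) (N : ℕ) :
    ∏ k ∈ Finset.range N, (y + x * t ^ k) =
      ∑ i ∈ Finset.range (N + 1), gaussBinom t N i * t ^ (i.choose 2) * x ^ i * y ^ (N - i) := by
  induction N generalizing x with
  | zero => simp
  | succ N ih =>
    -- Splitting off `k = 0` replaces `x` by `x * t`; the extra `t ^ i` is what the first Pascal
    -- recursion needs.
    have h1 : ∏ k ∈ Finset.range (N + 1), (y + x * t ^ k) =
        (y + x) * ∏ k ∈ Finset.range N, (y + x * t * t ^ k) := by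
      rw [Finset.prod_range_succ', mul_comm]
      simp only [pow_zero, mul_one, pow_succ']
      congr 1
      exact Finset.prod_congr rfl fun k _ => by ring
    rw [h1, ih, add_mul, Finset.sum_range_succ' _ (N + 1)]
    have h2 : y * ∑ i ∈ Finset.range (N + 1),
          gaussBinom t N i * t ^ (i.choose 2) * (x * t) ^ i * y ^ (N - i) =
        ∑ i ∈ Finset.range (N + 1), t ^ (i + 1) * gaussBinom t N (i + 1) *
          t ^ ((i + 1).choose 2) * x ^ (i + 1) * y ^ (N - i) + y ^ (N + 1) := by
      rw [Finset.sum_range_succ', mul_add, Finset.sum_range_succ,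
        gaussBinom_eq_zero_of_lt t (Nat.lt_succ_self N), Finset.mul_sum]
      simp only [mul_zero, zero_mul, add_zero, gaussBinom_zero_right, Nat.choose_zero_succ,
        pow_zero, mul_one, one_mul, Nat.sub_zero]
      rw [← pow_succ']
      congr 1
      refine Finset.sum_congr rfl fun i hi => ?_
      rw [Finset.mem_range] at hi
      rw [show N - i = N - (i + 1) + 1 by omega]
      ring
    rw [h2, Finset.mul_sum, add_right_comm, ← Finset.sum_add_distrib]
    congr 1
    · refine Finset.sum_congr rfl fun i hi => ?_
      rw [Finset.mem_range] at hi
      rw [show N + 1 - (i + 1) = N - i by omega, gaussBinom_succ_succ, Nat.choose_succ_succ' i 1,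
        Nat.choose_one_right]
      ring
    · simp

/-- Gaussian binomial coefficients far from the boundary agree to high order. -/
theorem pow_dvd_gaussBinom_sub (t : R) {d i j k l : ℕ} (hi : d ≤ i) (hj : d ≤ j) (hk : d ≤ k)
    (hl : d ≤ l) : t ^ d ∣ gaussBinom t (i + j) i - gaussBinom t (k + l) k := by
  -- Compare with the central coefficient: each unit step in `u` or `v` adds a multiple of `t ^ d`,
  -- by one of the two Pascal recursions.
  have key : ∀ u v, t ^ d ∣ gaussBinom t (d + u + (d + v)) (d + u) - gaussBinom t (d + d) d := by
    intro u v
    induction u with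
    | zero =>
      induction v with
      | zero => simp
      | succ v ih =>
        rcases d with _ | d
        · simp
        have h := gaussBinom_succ_succ' t d (d + 1 + v + 1)
        refine (dvd_add ih (Dvd.intro (gaussBinom t (d + (d + 1 + v + 1)) d * t ^ (v + 1)) rfl)).trans
          (dvd_of_eq ?_)
        rw [show d + 1 + 0 + (d + 1 + (v + 1)) = d + (d + 1 + v + 1) + 1 by omega, add_zero, h,
          show d + 1 + (d + 1 + v) = d + (d + 1 + v + 1) by omega]
        ring
    | succ u ih =>
      have h := gaussBinom_succ_succ t (d + u + (d + v)) (d + u)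
      refine (dvd_add ih (Dvd.intro (gaussBinom t (d + u + (d + v)) (d + u + 1) * t ^ (u + 1))
        rfl)).trans (dvd_of_eq ?_)
      rw [show d + (u + 1) + (d + v) = d + u + (d + v) + 1 by omega,
        show d + (u + 1) = d + u + 1 by omega, h]
      ring
  obtain ⟨i, rfl⟩ := Nat.exists_eq_add_of_le hi
  obtain ⟨j, rfl⟩ := Nat.exists_eq_add_of_le hj
  obtain ⟨k, rfl⟩ := Nat.exists_eq_add_of_le hk
  obtain ⟨l, rfl⟩ := Nat.exists_eq_add_of_le hl
  have := dvd_sub (key i j) (key k l)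
  rwa [sub_sub_sub_cancel_right] at this

/-- The theta series `∑ ε ^ |x| X ^ (x ^ 2)` over all integers `x`. It is meant for `ε = ±1`. -/
noncomputable def theta (ε : R) : R⟦X⟧ :=
  mk fun n => if n = 0 then 1 else if IsSquare n then 2 * ε ^ n else 0

theorem sum_Icc_neg_natAbs {M : Type*} [AddCommMonoid M] (g : ℕ → M) (N : ℕ) :
    ∑ x ∈ Finset.Icc (-N : ℤ) N, g x.natAbs = g 0 + 2 • ∑ k ∈ Finset.range N, g (k + 1) := by
  induction N with
  | zero => simp
  | succ N ih =>
    have : Finset.Icc (-(N + 1 : ℕ) : ℤ) (N + 1 : ℕ) =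
        insert (-(N + 1 : ℕ) : ℤ) (insert ((N + 1 : ℕ) : ℤ) (Finset.Icc (-N : ℤ) N)) := by
      ext x; simp; omega
    rw [this, Finset.sum_insert (by simp; omega), Finset.sum_insert (by simp), ih,
      Finset.sum_range_succ, Int.natAbs_neg, Int.natAbs_natCast, smul_add, two_smul _ (g (N + 1))]
    ac_rfl

theorem pow_eq_pow_of_even_add {ε : R} (hε : ε ^ 2 = 1) {a b : ℕ} (h : Even (a + b)) :
    ε ^ a = ε ^ b := by
  obtain ⟨c, hc⟩ := h
  have h1 : ε ^ a * ε ^ b = 1 := by rw [← pow_add, hc, ← two_mul, pow_mul, hε, one_pow]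
  have h2 : ε ^ b * ε ^ b = 1 := by rw [← pow_add, ← two_mul, pow_mul, hε, one_pow]
  calc ε ^ a = ε ^ a * (ε ^ b * ε ^ b) := by rw [h2, mul_one]
    _ = ε ^ b := by rw [← mul_assoc, h1, one_mul]

theorem coeff_theta {ε : R} (hε : ε ^ 2 = 1) {n N : ℕ} (hn : n ≤ N) :
    coeff n (theta ε) =
      ∑ x ∈ Finset.Icc (-N : ℤ) N, if n = x.natAbs ^ 2 then ε ^ x.natAbs else 0 := by
  rw [sum_Icc_neg_natAbs (fun k => if n = k ^ 2 then ε ^ k else 0), theta, coeff_mk]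
  by_cases h0 : n = 0
  · subst h0
    rw [Finset.sum_eq_zero fun k _ => if_neg (by positivity)]
    simp
  rw [if_neg h0]
  simp only [zero_pow two_ne_zero, if_neg h0, zero_add]
  split_ifs with hs
  · obtain ⟨r, rfl⟩ := hs
    obtain ⟨r, rfl⟩ := Nat.exists_eq_succ_of_ne_zero (show r ≠ 0 by rintro rfl; simp at h0)
    rw [Finset.sum_eq_single r, if_pos (sq (r + 1)).symm]
    · have hpow : ∀ m, ε ^ (m * m) = ε ^ m := fun m =>
        pow_eq_pow_of_even_add hε (by rw [← Nat.mul_succ]; exact Nat.even_mul_succ_self m)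
      rw [nsmul_eq_mul, Nat.succ_eq_add_one, hpow]
      simp
    · intro k _ hk
      refine if_neg fun h => hk ?_
      rw [← sq] at h
      have := Nat.pow_left_injective two_ne_zero h
      omega
    · intro h
      exfalso
      apply h
      rw [Finset.mem_range]
      nlinarith
  · rw [Finset.sum_eq_zero, smul_zero]
    intro k _
    refine if_neg fun h => hs ⟨k + 1, by rw [h, sq]⟩

theorem X_pow_dvd_theta_sub {ε : R} (hε : ε ^ 2 = 1) (N : ℕ) :
    (X : R⟦X⟧) ^ (N + 1) ∣ theta ε -
      ∑ x ∈ Finset.Icc (-N : ℤ) N, C (ε ^ x.natAbs) * X ^ (x.natAbs ^ 2) := by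
  refine X_pow_dvd_iff.2 fun n hn => ?_
  rw [map_sub, coeff_theta hε (Nat.lt_succ_iff.1 hn), map_sum, sub_eq_zero]
  refine Finset.sum_congr rfl fun x _ => ?_
  rw [coeff_C_mul, coeff_X_pow, mul_ite, mul_one, mul_zero]

/-- A finite form of the Jacobi triple product at `z = ε`. -/
theorem prod_sq_eq_sum_gaussBinom {ε : R} (hε : ε ^ 2 = 1) (n : ℕ) :
    (∏ k ∈ Finset.range n, (1 + C ε * (X : R⟦X⟧) ^ (2 * k + 1))) ^ 2 =
      ∑ x ∈ Finset.Icc (-n : ℤ) n, gaussBinom (X ^ 2) (2 * n) (n + x).toNat *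
        (C (ε ^ x.natAbs) * X ^ (x.natAbs ^ 2)) := by
  rcases n with _ | m
  · simp
  -- Rothe's product with `t = X ^ 2`, `x = ε`, `y = X ^ (2m+1)`. Pulling out `ε X ^ (2k)` from the
  -- lower half and `X ^ (2m+1)` from the upper half leaves the same product twice.
  have hfac : ∏ k ∈ Finset.range (2 * (m + 1)), ((X : R⟦X⟧) ^ (2 * m + 1) + C ε * (X ^ 2) ^ k) =
      C ε ^ (m + 1) * X ^ ((3 * m + 1) * (m + 1)) *
        (∏ k ∈ Finset.range (m + 1), (1 + C ε * (X : R⟦X⟧) ^ (2 * k + 1))) ^ 2 := by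
    have hC : C ε * C ε = (1 : R⟦X⟧) := by rw [← map_mul, ← sq, hε, map_one]
    have hlow : ∏ k ∈ Finset.range (m + 1), ((X : R⟦X⟧) ^ (2 * m + 1) + C ε * (X ^ 2) ^ k) =
        C ε ^ (m + 1) * X ^ (m * (m + 1)) *
          ∏ k ∈ Finset.range (m + 1), (1 + C ε * (X : R⟦X⟧) ^ (2 * k + 1)) := by
      rw [← Finset.prod_range_reflect (fun k => 1 + C ε * (X : R⟦X⟧) ^ (2 * k + 1)),
        show m * (m + 1) = 2 * ∑ k ∈ Finset.range (m + 1), k by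
          rw [mul_comm 2, Finset.sum_range_id_mul_two, Nat.add_sub_cancel, mul_comm],
        Finset.mul_sum, ← Finset.prod_pow_eq_pow_sum,
        show C ε ^ (m + 1) = ∏ k ∈ Finset.range (m + 1), (C ε : R⟦X⟧) by simp,
        ← Finset.prod_mul_distrib, ← Finset.prod_mul_distrib]
      refine Finset.prod_congr rfl fun k hk => ?_
      rw [Finset.mem_range] at hk
      have : (X : R⟦X⟧) ^ (2 * m + 1) = X ^ (2 * k) * X ^ (2 * (m + 1 - 1 - k) + 1) := by
        rw [← pow_add]; congr 1; omega
      rw [this, ← pow_mul]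
      linear_combination (-X ^ (2 * k) * X ^ (2 * (m + 1 - 1 - k) + 1)) * hC
    have hhigh : ∏ k ∈ Finset.range (m + 1),
        ((X : R⟦X⟧) ^ (2 * m + 1) + C ε * (X ^ 2) ^ (m + 1 + k)) =
        X ^ ((2 * m + 1) * (m + 1)) *
          ∏ k ∈ Finset.range (m + 1), (1 + C ε * (X : R⟦X⟧) ^ (2 * k + 1)) := by
      rw [pow_mul, show ((X : R⟦X⟧) ^ (2 * m + 1)) ^ (m + 1) =
        ∏ k ∈ Finset.range (m + 1), (X : R⟦X⟧) ^ (2 * m + 1) by simp, ← Finset.prod_mul_distrib]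
      exact Finset.prod_congr rfl fun k _ => by ring
    rw [two_mul, Finset.prod_range_add, hlow, hhigh]
    ring
  have hsum : ∏ k ∈ Finset.range (2 * (m + 1)), ((X : R⟦X⟧) ^ (2 * m + 1) + C ε * (X ^ 2) ^ k) =
      C ε ^ (m + 1) * X ^ ((3 * m + 1) * (m + 1)) *
        ∑ x ∈ Finset.Icc (-(m + 1 : ℕ) : ℤ) (m + 1 : ℕ),
          gaussBinom (X ^ 2) (2 * (m + 1)) ((m + 1 : ℕ) + x).toNat *
            (C (ε ^ x.natAbs) * X ^ (x.natAbs ^ 2)) := by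
    rw [prod_add_mul_pow_eq_sum_gaussBinom, Finset.mul_sum]
    refine Finset.sum_nbij' (fun i => (i : ℤ) - (m + 1 : ℕ)) (fun x => ((m + 1 : ℕ) + x).toNat)
      ?_ ?_ ?_ ?_ ?_
    · intro i hi; simp at hi ⊢; omega
    · intro x hx; simp at hx ⊢; omega
    · intro i _; simp
    · intro x hx; simp at hx ⊢; omega
    · intro i hi
      rw [Finset.mem_range] at hi
      have h1 : ε ^ i = ε ^ (m + 1) * ε ^ ((i : ℤ) - (m + 1 : ℕ)).natAbs := by
        rw [← pow_add]
        refine pow_eq_pow_of_even_add hε ?_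
        rw [Nat.even_iff]
        omega
      -- Completing the square at the centre `i = m + 1`.
      have h2 : 2 * i.choose 2 + (2 * m + 1) * (2 * (m + 1) - i) =
          (3 * m + 1) * (m + 1) + ((i : ℤ) - (m + 1 : ℕ)).natAbs ^ 2 := by
        have h3 : 2 * (i.choose 2 : ℤ) = i * (i - 1) := by
          rcases i with _ | i
          · simp
          · have h4 := Finset.sum_range_id_mul_two (i + 1)
            rw [Finset.sum_range_id, ← Nat.choose_two_right, Nat.add_sub_cancel] at h4
            have h5 : (((i + 1).choose 2 * 2 : ℕ) : ℤ) = ((i + 1) * i : ℕ) := by rw [h4]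
            push_cast at h5 ⊢
            linarith
        zify [show i ≤ 2 * (m + 1) by omega]
        rw [sq_abs]
        linear_combination h3
      rw [add_sub_cancel, Int.toNat_natCast, ← map_pow, ← map_pow, h1, map_mul, ← pow_mul, ← pow_mul]
      calc _ = gaussBinom (X ^ 2) (2 * (m + 1)) i * (C (ε ^ (m + 1)) *
            C (ε ^ ((i : ℤ) - (m + 1 : ℕ)).natAbs)) *
              X ^ (2 * i.choose 2 + (2 * m + 1) * (2 * (m + 1) - i)) := by
            rw [pow_add]; ring
        _ = _ := by rw [h2, pow_add]; ring
  have hε' : IsUnit (C ε : R⟦X⟧) := (IsUnit.of_mul_eq_one ε (by rw [← sq, hε])).map C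
  have := hfac.symm.trans hsum
  rw [mul_assoc, mul_assoc] at this
  exact X_pow_mul_cancel ((hε'.pow (m + 1)).mul_left_cancel this)

/-- The truncated Jacobi triple product at `z = ε`. -/
theorem X_pow_dvd_prod_sq_sub {ε : R} (hε : ε ^ 2 = 1) {N n : ℕ} (hn : 2 * N ≤ n) :
    (X : R⟦X⟧) ^ N ∣ (∏ k ∈ Finset.range n, (1 + C ε * (X : R⟦X⟧) ^ (2 * k + 1))) ^ 2 -
      theta ε * gaussBinom (X ^ 2) (2 * n) n := by
  have h1 : (X : R⟦X⟧) ^ N ∣ theta ε -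
      ∑ x ∈ Finset.Icc (-n : ℤ) n, C (ε ^ x.natAbs) * X ^ (x.natAbs ^ 2) :=
    (pow_dvd_pow _ (by omega)).trans (X_pow_dvd_theta_sub hε n)
  have h2 : (X : R⟦X⟧) ^ N ∣ (∏ k ∈ Finset.range n, (1 + C ε * (X : R⟦X⟧) ^ (2 * k + 1))) ^ 2 -
      (∑ x ∈ Finset.Icc (-n : ℤ) n, C (ε ^ x.natAbs) * X ^ (x.natAbs ^ 2)) *
        gaussBinom (X ^ 2) (2 * n) n := by
    rw [prod_sq_eq_sum_gaussBinom hε, Finset.sum_mul, ← Finset.sum_sub_distrib]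
    refine Finset.dvd_sum fun x hx => ?_
    rw [mul_comm, ← mul_sub]
    rw [Finset.mem_Icc] at hx
    -- Terms with large `|x|` die through `X ^ (x²)`; for the others `n ± x ≥ N`, so the Gaussian
    -- binomial agrees with the central one.
    by_cases hxN : N ≤ x.natAbs
    · refine dvd_mul_of_dvd_left (dvd_mul_of_dvd_right (pow_dvd_pow _ ?_) _) _
      nlinarith
    · refine dvd_mul_of_dvd_right ?_ _
      have := pow_dvd_gaussBinom_sub ((X : R⟦X⟧) ^ 2) (d := N) (i := (n + x).toNat)
        (j := (n - x).toNat) (k := n) (l := n) (by omega) (by omega) (by omega) (by omega)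
      rw [show (n + x).toNat + (n - x).toNat = 2 * n by omega, ← two_mul, ← pow_mul] at this
      exact (pow_dvd_pow _ (by omega)).trans this
  convert! dvd_sub h2 (h1.mul_right (gaussBinom (X ^ 2) (2 * n) n)) using 1
  ring

end Theta

/-! ### Theta identities through binary quadratic forms -/

section ThetaIdentities

variable {R : Type*} [CommRing R]

/-- The representations of `n` by the binary form `k x ^ 2 + l y ^ 2`, for positive `k` and `l`. -/
noncomputable def diagReps (k l n : ℕ) : Finset (ℤ × ℤ) :=
  (Finset.Icc (-n : ℤ) n ×ˢ Finset.Icc (-n : ℤ) n).filter fun p =>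
    (n : ℤ) = k * p.1 ^ 2 + l * p.2 ^ 2

theorem mem_diagReps {k l n : ℕ} (hk : k ≠ 0) (hl : l ≠ 0) {p : ℤ × ℤ} :
    p ∈ diagReps k l n ↔ (n : ℤ) = k * p.1 ^ 2 + l * p.2 ^ 2 := by
  rw [diagReps, Finset.mem_filter, and_iff_right_iff_imp, Finset.mem_product, Finset.mem_Icc,
    Finset.mem_Icc]
  intro h
  have hk' : (1 : ℤ) ≤ k := by exact_mod_cast Nat.one_le_iff_ne_zero.2 hk
  have hl' : (1 : ℤ) ≤ l := by exact_mod_cast Nat.one_le_iff_ne_zero.2 hl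
  have h1 : p.1 ^ 2 ≤ n := by nlinarith [sq_nonneg p.1, sq_nonneg p.2]
  have h2 : p.2 ^ 2 ≤ n := by nlinarith [sq_nonneg p.1, sq_nonneg p.2]
  have key : ∀ x : ℤ, x ^ 2 ≤ n → -(n : ℤ) ≤ x ∧ x ≤ n := fun x hx => by
    have := Int.natAbs_le_self_sq x
    omega
  exact ⟨key _ h1, key _ h2⟩

theorem X_pow_dvd_expand {f : R⟦X⟧} {N k : ℕ} (hk : k ≠ 0) (h : (X : R⟦X⟧) ^ N ∣ f) :
    (X : R⟦X⟧) ^ N ∣ expand k hk f := by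
  obtain ⟨g, rfl⟩ := h
  rw [map_mul, map_pow, expand_X, ← pow_mul]
  exact dvd_mul_of_dvd_left (pow_dvd_pow _ (Nat.le_mul_of_pos_left N (by omega))) _

theorem coeff_expand_theta_mul {ε δ : R} (hε : ε ^ 2 = 1) (hδ : δ ^ 2 = 1) {k l : ℕ} (hk : k ≠ 0)
    (hl : l ≠ 0) (n : ℕ) : coeff n (expand k hk (theta ε) * expand l hl (theta δ)) =
      ∑ p ∈ diagReps k l n, ε ^ p.1.natAbs * δ ^ p.2.natAbs := by
  have key : ∀ {ε : R} (_ : ε ^ 2 = 1) {k : ℕ} (hk : k ≠ 0), (X : R⟦X⟧) ^ (n + 1) ∣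
      expand k hk (theta ε) -
        ∑ x ∈ Finset.Icc (-n : ℤ) n, C (ε ^ x.natAbs) * X ^ (k * x.natAbs ^ 2) := by
    intro ε hε k hk
    have := X_pow_dvd_expand hk (X_pow_dvd_theta_sub hε n)
    simpa only [map_sub, map_sum, map_mul, expand_C, map_pow, expand_X, ← pow_mul] using this
  obtain ⟨c, hc⟩ := key hε hk
  obtain ⟨d, hd⟩ := key hδ hl
  rw [sub_eq_iff_eq_add] at hc hd
  rw [hc, hd, add_mul, mul_add (∑ x ∈ _, _), mul_assoc, mul_left_comm (∑ x ∈ _, _), map_add,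
    map_add, coeff_X_pow_mul', if_neg (by omega), coeff_X_pow_mul', if_neg (by omega), zero_add,
    zero_add, Finset.sum_mul_sum, ← Finset.sum_product', map_sum, diagReps, Finset.sum_filter]
  refine Finset.sum_congr rfl fun p _ => ?_
  rw [mul_mul_mul_comm, ← map_mul, ← pow_add, coeff_C_mul, coeff_X_pow, mul_ite, mul_one, mul_zero]
  refine if_congr ?_ rfl rfl
  zify
  rw [sq_abs, sq_abs]

/-- For even `n`, `(x, y) ↦ (x + y, x - y)` matches representations by `2x² + 2y²` and by `x² + y²`.
For odd `n`, swapping coordinates of opposite parity reverses the sign, so everything cancels. -/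
theorem theta_mul_theta_neg :
    theta (1 : R) * theta (-1) = expand 2 two_ne_zero (theta (-1)) ^ 2 := by
  ext n
  have hL := coeff_expand_theta_mul (one_pow 2) (neg_one_sq (R := R)) one_ne_zero one_ne_zero n
  rw [expand_one_apply, expand_one_apply] at hL
  rw [hL, sq, coeff_expand_theta_mul neg_one_sq neg_one_sq]
  simp only [one_pow, one_mul]
  rcases Nat.even_or_odd n with hn | hn
  · have hpar : ∀ p ∈ diagReps 1 1 n, (p.1 + p.2) % 2 = 0 := by
      intro p hp
      rw [mem_diagReps one_ne_zero one_ne_zero] at hp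
      obtain ⟨m, rfl⟩ := hn
      rw [← Int.even_iff]
      have : Even (p.1 ^ 2 + p.2 ^ 2) := ⟨m, by push_cast at hp; linarith⟩
      simpa [parity_simps] using this
    symm
    refine Finset.sum_bij' (fun p _ => (p.1 + p.2, p.1 - p.2))
      (fun p _ => ((p.1 + p.2) / 2, (p.1 - p.2) / 2)) ?_ ?_ ?_ ?_ ?_
    · intro p hp
      rw [mem_diagReps (by simp) (by simp)] at hp ⊢
      push_cast at hp ⊢
      linarith
    · intro p hp
      have h2 := hpar p hp
      rw [mem_diagReps (by simp) (by simp)] at hp ⊢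
      obtain ⟨c, hc⟩ := Int.dvd_of_emod_eq_zero h2
      obtain ⟨x, y⟩ := p
      obtain rfl : x = 2 * c - y := by simp at hc; omega
      simp only at hp ⊢
      rw [show (2 * c - y + y) / 2 = c by omega, show (2 * c - y - y) / 2 = c - y by omega]
      push_cast at hp ⊢
      linarith
    · intro p _; ext <;> simp <;> omega
    · intro p hp; have := hpar p hp; ext <;> simp <;> omega
    · intro p _
      rw [← pow_add]
      refine pow_eq_pow_of_even_add neg_one_sq ?_
      rw [Nat.even_iff]
      omega
  · have hpar : ∀ p ∈ diagReps 1 1 n, (p.1 + p.2) % 2 = 1 := by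
      intro p hp
      rw [mem_diagReps one_ne_zero one_ne_zero] at hp
      obtain ⟨m, rfl⟩ := hn
      rw [← Int.odd_iff]
      have : Odd (p.1 ^ 2 + p.2 ^ 2) := ⟨m, by push_cast at hp; linarith⟩
      simpa [parity_simps] using this
    have hempty : diagReps 2 2 n = ∅ := by
      refine Finset.eq_empty_of_forall_notMem fun p hp => ?_
      rw [mem_diagReps two_ne_zero two_ne_zero] at hp
      obtain ⟨m, rfl⟩ := hn
      push_cast at hp
      omega
    rw [hempty, Finset.sum_empty]
    refine Finset.sum_involution (fun p _ => p.swap) ?_ ?_ ?_ ?_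
    · intro p hp
      have h1 := hpar p hp
      have : (-1 : R) ^ p.1.natAbs = -(-1) ^ p.2.natAbs := by
        rw [← mul_neg_one ((-1 : R) ^ _), ← pow_succ]
        refine pow_eq_pow_of_even_add neg_one_sq ?_
        rw [Nat.even_iff]
        omega
      rw [Prod.snd_swap, this, add_neg_cancel]
    · intro p hp _ h
      have h1 := hpar p hp
      have := congrArg Prod.fst h
      simp at this
      omega
    · intro p hp
      rw [mem_diagReps one_ne_zero one_ne_zero] at hp ⊢
      simp only [Prod.fst_swap, Prod.snd_swap]
      linarith
    · intro p _; exact p.swap_swap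

/-- Multiplication by a primitive cube root of unity acts freely on the elements
`y + x * √-3` of a given even nonzero norm. -/
theorem three_dvd_card_diagReps {n : ℕ} (hn : Even n) (h0 : n ≠ 0) :
    3 ∣ (diagReps 3 1 n).card := by
  have hpar : ∀ p ∈ diagReps 3 1 n, (p.2 - p.1) % 2 = 0 := by
    intro p hp
    rw [mem_diagReps three_ne_zero one_ne_zero] at hp
    obtain ⟨m, rfl⟩ := hn
    rw [← Int.even_iff]
    have : Even (p.2 ^ 2 - p.1 ^ 2) := ⟨m - 2 * p.1 ^ 2, by push_cast at hp; linarith⟩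
    simpa [parity_simps] using this
  -- These are the coordinates of `(y + x√-3) · (-1 + √-3)/2`.
  have hmaps : ∀ p ∈ diagReps 3 1 n,
      ((p.2 - p.1) / 2, -(p.2 + 3 * p.1) / 2) ∈ diagReps 3 1 n := by
    intro p hp
    have h2 := hpar p hp
    rw [mem_diagReps three_ne_zero one_ne_zero] at hp ⊢
    obtain ⟨t, ht⟩ := Int.dvd_of_emod_eq_zero h2
    obtain ⟨x, y⟩ := p
    obtain rfl : y = x + 2 * t := by simp at ht; omega
    simp only at hp ⊢
    rw [show (x + 2 * t - x) / 2 = t by omega,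
      show -(x + 2 * t + 3 * x) / 2 = -(2 * x + t) by omega]
    push_cast at hp ⊢
    linarith
  let f : Function.End (diagReps 3 1 n) := fun p => ⟨_, hmaps p.1 p.2⟩
  have hf : f ^ 3 ^ 1 = 1 := by
    funext p
    change f (f (f p)) = p
    have := hpar p.1 p.2
    ext <;> simp only [f] <;> omega
  have hcard := Equiv.Perm.card_fixedPoints_modEq hf
  have hfix : IsEmpty f.fixedPoints := by
    refine ⟨fun ⟨p, hp⟩ => h0 ?_⟩
    have h1 := congrArg (fun q => q.1.1) hp
    have h2 := congrArg (fun q => q.1.2) hp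
    have h3 := hpar p.1 p.2
    have h4 := (mem_diagReps three_ne_zero one_ne_zero).1 p.2
    simp only [f] at h1 h2
    obtain ⟨h5, h6⟩ : p.1.1 = 0 ∧ p.1.2 = 0 := by omega
    rw [h5, h6] at h4
    simpa using h4
  rw [Fintype.card_coe, Fintype.card_eq_zero] at hcard
  exact (Nat.modEq_zero_iff_dvd).1 hcard

/-! ### Series modulo 3 and residue classes of exponents -/

theorem expand_three_eq_pow (f : (ZMod 3)⟦X⟧) : expand 3 three_ne_zero f = f ^ 3 := by
  have := MvPowerSeries.map_frobenius_expand (σ := Unit) (R := ZMod 3) 3 three_ne_zero (f := f)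
  rw [ZMod.frobenius_zmod] at this
  rw [← this]
  ext n
  rfl

/-- The constancy mod `3` of a weight two modular form. -/
theorem theta_pow_four_add : theta (1 : ZMod 3) ^ 4 + theta (-1) ^ 4 = -1 := by
  -- Frobenius turns the fourth power into `θ(q³) θ(q)`, and `x + y` has the parity of `n = 3x² +
  -- y²`. Adding both signs kills odd `n`.
  have key : ∀ ε : ZMod 3, ε ^ 2 = 1 → ∀ n, coeff n (theta ε ^ 4) =
      ε ^ n * (diagReps 3 1 n).card := by
    intro ε hε n
    have h := coeff_expand_theta_mul hε hε three_ne_zero one_ne_zero n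
    rw [expand_one_apply, expand_three_eq_pow, ← pow_succ] at h
    rw [h, Finset.sum_congr rfl (g := fun _ => ε ^ n), Finset.sum_const, nsmul_eq_mul, mul_comm]
    intro p hp
    rw [mem_diagReps three_ne_zero one_ne_zero] at hp
    rw [← pow_add]
    refine pow_eq_pow_of_even_add hε ?_
    have : Even ((n : ℤ) + p.1 + p.2) := by
      have h3 : ¬ Even (3 : ℤ) := by decide
      rw [hp]
      simp [parity_simps, h3]
      tauto
    rw [Int.even_iff] at this
    rw [Nat.even_iff]
    omega
  ext n
  rw [map_add, key _ (one_pow 2), key _ neg_one_sq, one_pow, one_mul, map_neg, coeff_one]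
  rcases eq_or_ne n 0 with rfl | h0
  · decide
  rw [if_neg h0, neg_zero]
  rcases Nat.even_or_odd n with hn | hn
  · have := (ZMod.natCast_eq_zero_iff _ 3).2 (three_dvd_card_diagReps hn h0)
    rw [this]
    simp
  · rw [hn.neg_one_pow]
    ring

/-- The power series `f` has only exponents congruent to `r` mod `3`. -/
def SupportedMod (r : ZMod 3) (f : R⟦X⟧) : Prop :=
  ∀ n : ℕ, (n : ZMod 3) ≠ r → coeff n f = 0

theorem SupportedMod.mul {r s : ZMod 3} {f g : R⟦X⟧} (hf : SupportedMod r f)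
    (hg : SupportedMod s g) : SupportedMod (r + s) (f * g) := by
  intro n hn
  rw [coeff_mul]
  refine Finset.sum_eq_zero fun p hp => ?_
  rw [Finset.HasAntidiagonal.mem_antidiagonal] at hp
  by_cases h1 : (p.1 : ZMod 3) = r
  · rw [hg p.2 fun h2 => hn (by rw [← hp, Nat.cast_add, h1, h2]), mul_zero]
  · rw [hf p.1 h1, zero_mul]

theorem supportedMod_pow_three (f : (ZMod 3)⟦X⟧) : SupportedMod 0 (f ^ 3) := by
  intro n hn
  rw [← expand_three_eq_pow, coeff_expand_of_not_dvd]
  rwa [← ZMod.natCast_eq_zero_iff]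

/-- The ninth power is `θ(q⁹)`, the terms with `3 ∣ x`; all other squares are 1 mod 3. Signs agree
because `9m` and `m` have the same parity. -/
theorem supportedMod_theta_sub {ε : ZMod 3} (hε : ε ^ 2 = 1) :
    SupportedMod 1 (theta ε - theta ε ^ 9) := by
  intro n hn
  have hsq : ∀ r : ℕ, (r * r) % 3 = 0 ∧ r % 3 = 0 ∨ (r * r) % 3 = 1 := by
    intro r
    have : r % 3 = 0 ∨ r % 3 = 1 ∨ r % 3 = 2 := by omega
    rcases this with h | h | h <;> simp [Nat.mul_mod, h]
  rw [map_sub, sub_eq_zero, show 9 = 3 * 3 by rfl, pow_mul, ← expand_three_eq_pow,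
    ← expand_three_eq_pow, ← expand_mul, coeff_expand]
  have hn1 : n % 3 ≠ 1 := by
    intro h
    apply hn
    rw [← ZMod.natCast_mod, h, Nat.cast_one]
  split_ifs with h9
  · obtain ⟨m, rfl⟩ := h9
    rw [Nat.mul_div_cancel_left _ (by norm_num), theta, coeff_mk, coeff_mk]
    have h1 : IsSquare (3 * 3 * m) ↔ IsSquare m := by
      constructor
      · rintro ⟨r, hr⟩
        obtain ⟨h, h3⟩ | h := hsq r
        · obtain ⟨s, rfl⟩ := Nat.dvd_of_mod_eq_zero h3
          exact ⟨s, by nlinarith⟩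
        · omega
      · rintro ⟨r, rfl⟩
        exact ⟨3 * r, by ring⟩
    rw [pow_eq_pow_of_even_add hε (a := 3 * 3 * m) (b := m) (by rw [Nat.even_iff]; omega)]
    simp [h1]
  · rw [theta, coeff_mk, if_neg (by rintro rfl; simp at h9), if_neg]
    rintro ⟨r, rfl⟩
    obtain ⟨h, h3⟩ | h := hsq r
    · obtain ⟨s, rfl⟩ := Nat.dvd_of_mod_eq_zero h3
      exact h9 ⟨s * s, by ring⟩
    · exact hn1 h

theorem constantCoeff_theta (ε : R) : constantCoeff (theta ε) = 1 := by
  rw [← coeff_zero_eq_constantCoeff_apply, theta, coeff_mk, if_pos rfl]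

end ThetaIdentities

/-! ### The theta quotient and the trisection modulo 3 -/

/-- The square of the generating function of overpartitions into odd parts is a quotient of
theta series. -/
theorem overpartitionOddSeries_sq_mul_theta (R : Type*) [CommRing R] :
    overpartitionOddSeries R ^ 2 * theta (-1) = theta 1 := by
  rw [← sub_eq_zero]
  suffices h : ∀ N, (X : R⟦X⟧) ^ N ∣ overpartitionOddSeries R ^ 2 * theta (-1) - theta 1 by
    ext n
    exact X_pow_dvd_iff.1 (h (n + 1)) n n.lt_succ_self
  intro N
  obtain ⟨n₀, hn₀⟩ := X_pow_dvd_overpartitionOddSeries_mul_sub R N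
  obtain ⟨c, hc⟩ := hn₀ (max n₀ (2 * N)) (le_max_left _ _)
  obtain ⟨d, hd⟩ := X_pow_dvd_prod_sq_sub (one_pow 2 : (1 : R) ^ 2 = 1) (le_max_right n₀ (2 * N))
  obtain ⟨e, he⟩ := X_pow_dvd_prod_sq_sub (neg_one_sq (R := R)) (le_max_right n₀ (2 * N))
  generalize max n₀ (2 * N) = n at hc hd he
  simp only [map_neg, map_one, one_mul, neg_mul, ← sub_eq_add_neg] at hd he
  have hE : IsUnit (gaussBinom ((X : R⟦X⟧) ^ 2) (2 * n) n) := by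
    have h := (dvd_pow_self (X : R⟦X⟧) two_ne_zero).trans
      (dvd_gaussBinom_sub_one (X ^ 2) (show n ≤ 2 * n by omega))
    rw [X_dvd_iff, map_sub, map_one, sub_eq_zero] at h
    rw [isUnit_iff_constantCoeff, h]
    exact isUnit_one
  have hb : IsUnit (theta (-1 : R)) := by
    rw [isUnit_iff_constantCoeff, constantCoeff_theta]
    exact isUnit_one
  -- The truncated products only give the theta series times the Gaussian binomial, so multiply by
  -- units to use them.
  rw [← (hE.mul hb).dvd_mul_right]
  set Dm := ∏ k ∈ Finset.range n, (1 - (X : R⟦X⟧) ^ (2 * k + 1))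
  set Dp := ∏ k ∈ Finset.range n, (1 + (X : R⟦X⟧) ^ (2 * k + 1))
  set E := gaussBinom ((X : R⟦X⟧) ^ 2) (2 * n) n
  set P := overpartitionOddSeries R
  refine ⟨theta (-1) * (c * (P * Dm + Dp) + d - P ^ 2 * e), ?_⟩
  linear_combination theta (-1) * (P * Dm + Dp) * hc + theta (-1) * hd - P ^ 2 * theta (-1) * he

theorem eq_of_sq_eq_sq_of_constantCoeff {f g : (ZMod 3)⟦X⟧} (h : f ^ 2 = g ^ 2)
    (hf : constantCoeff f = 1) (hg : constantCoeff g = 1) : f = g := by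
  rcases sq_eq_sq_iff_eq_or_eq_neg.1 h with h | h
  · exact h
  · rw [h, map_neg, hg] at hf
    exact absurd hf (by decide)

theorem overpartitionOddSeries_mul_theta_eq :
    overpartitionOddSeries (ZMod 3) * theta 1 * theta (-1) ^ 2 =
      expand 2 two_ne_zero (theta (-1)) ^ 3 := by
  have h1 := overpartitionOddSeries_sq_mul_theta (ZMod 3)
  have h2 := theta_mul_theta_neg (R := ZMod 3)
  refine eq_of_sq_eq_sq_of_constantCoeff ?_ ?_ ?_
  · linear_combination theta 1 ^ 2 * theta (-1) ^ 3 * h1 +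
      ((theta 1 * theta (-1)) ^ 2 + theta 1 * theta (-1) * expand 2 two_ne_zero (theta (-1)) ^ 2 +
        expand 2 two_ne_zero (theta (-1)) ^ 4) * h2
  · simp [constantCoeff_theta, constantCoeff_overpartitionOddSeries]
  · simp [constantCoeff_theta]

/-- The trisection of the generating function of overpartitions into odd parts, mod `3`. -/
theorem overpartitionOdd_three_mul (m : ℕ) : (overpartitionOdd (3 * m) : ZMod 3) =
    coeff m (theta (-1 : ZMod 3) * expand 6 (by norm_num) (theta (-1))) := by
  set a := theta (1 : ZMod 3) with ha
  set b := theta (-1 : ZMod 3) with hb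
  set P := overpartitionOddSeries (ZMod 3) with hP
  set V := a⁻¹ with hV
  have hVa : V * a = 1 := PowerSeries.inv_mul_cancel a (by rw [ha, constantCoeff_theta]; decide)
  have h3 : (3 : (ZMod 3)⟦X⟧) = 0 := by
    have : (3 : ZMod 3) = 0 := rfl
    rw [← map_ofNat (C (R := ZMod 3)) 3, this, map_zero]
  have hsq : P ^ 2 * b = a := overpartitionOddSeries_sq_mul_theta _
  have hab : a ^ 4 + b ^ 4 = -1 := theta_pow_four_add
  have hPab : P * a * b ^ 2 = expand 2 two_ne_zero b ^ 3 := overpartitionOddSeries_mul_theta_eq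
  have ha1 : SupportedMod 1 (a - a ^ 9) := supportedMod_theta_sub (one_pow 2)
  have hb1 : SupportedMod 1 (b - b ^ 9) := supportedMod_theta_sub neg_one_sq
  have ha0 : SupportedMod 0 (a ^ 9) := by
    rw [show 9 = 3 * 3 by rfl, pow_mul]; exact supportedMod_pow_three _
  have hb0 : SupportedMod 0 (b ^ 9) := by
    rw [show 9 = 3 * 3 by rfl, pow_mul]; exact supportedMod_pow_three _
  have hPV : SupportedMod 0 ((P * V) ^ 3) := supportedMod_pow_three _
  -- The left side is the part of `a ^ 2 * b` with exponents divisible by `3`.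
  have hpart : a ^ 18 * b ^ 9 + (a - a ^ 9) ^ 2 * (b - b ^ 9) = a ^ 6 * b ^ 9 := by
    -- Put `s = a⁴`: then `b⁸ = (1 + s)²`, and the remaining polynomial in `s` is a multiple of 3.
    linear_combination a ^ 2 * b * (a ^ 16 - a ^ 4 - (1 - a ^ 8) ^ 2) * (b ^ 4 - 1 - a ^ 4) * hab +
      a ^ 6 * b * ((1 + a ^ 4) ^ 2 * (a ^ 8 - a ^ 4) - (1 - a ^ 8) ^ 2) * h3
  -- Expand `a² b` along `a = a⁹ + (a - a⁹)` and likewise for `b`: the groups have exponents 0, 1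
  -- and 2 mod 3. Cross terms are repeated so that each summand is a plain product.
  have hdecomp : P = (P * a * b ^ 3) ^ 3 +
      ((P * V) ^ 3 * (a ^ 9 * a ^ 9 * (b - b ^ 9)) + (P * V) ^ 3 * ((a - a ^ 9) * a ^ 9 * b ^ 9) +
        (P * V) ^ 3 * ((a - a ^ 9) * a ^ 9 * b ^ 9)) +
      ((P * V) ^ 3 * ((a - a ^ 9) * (a - a ^ 9) * b ^ 9) +
        (P * V) ^ 3 * ((a - a ^ 9) * a ^ 9 * (b - b ^ 9)) +
        (P * V) ^ 3 * ((a - a ^ 9) * a ^ 9 * (b - b ^ 9))) := by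
    have e1 : P = (P * V) ^ 3 * (a ^ 2 * b) := by
      linear_combination (-P * (V ^ 2 * a ^ 2 + V * a + 1)) * hVa - P * V ^ 3 * a ^ 2 * hsq
    have e2 : (P * a * b ^ 3) ^ 3 = (P * V) ^ 3 * (a ^ 6 * b ^ 9) := by
      linear_combination (-P ^ 3 * a ^ 3 * b ^ 9 * (V ^ 2 * a ^ 2 + V * a + 1)) * hVa
    rw [e2, ← hpart]
    nth_rewrite 1 [e1]
    ring
  have hvan : ∀ {r : ZMod 3} {f : (ZMod 3)⟦X⟧}, r ≠ 0 → SupportedMod r f →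
      coeff (3 * m) f = 0 := by
    intro r f hr hf
    refine hf _ fun h => hr ?_
    rw [← h, Nat.cast_mul, show ((3 : ℕ) : ZMod 3) = 0 by rfl, zero_mul]
  have hm : (overpartitionOdd (3 * m) : ZMod 3) = coeff (3 * m) P := by
    rw [hP, overpartitionOddSeries, coeff_mk]
  rw [hm, hdecomp]
  simp only [map_add]
  rw [hvan (by decide) (hPV.mul ((ha0.mul ha0).mul hb1)),
    hvan (by decide) (hPV.mul ((ha1.mul ha0).mul hb0)),
    hvan (by decide) (hPV.mul ((ha1.mul ha1).mul hb0)),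
    hvan (by decide) (hPV.mul ((ha1.mul ha0).mul hb1)),
    ← expand_three_eq_pow, coeff_expand_mul]
  have h6 : expand 6 (by norm_num) b = expand 2 two_ne_zero b ^ 3 := by
    rw [← expand_three_eq_pow, ← expand_mul]
  rw [h6, ← hPab, add_zero, add_zero, add_zero, add_zero]
  congr 1
  ring

/-! ### Numbers not of the form `x² + 6y²` -/

theorem three_dvd_overpartitionOdd_three_mul {m : ℕ}
    (hm : ∀ x y : ℤ, (m : ℤ) ≠ x ^ 2 + 6 * y ^ 2) : overpartitionOdd (3 * m) ≡ 0 [MOD 3] := by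
  rw [Nat.modEq_zero_iff_dvd, ← ZMod.natCast_eq_zero_iff, overpartitionOdd_three_mul]
  have h := coeff_expand_theta_mul (neg_one_sq (R := ZMod 3)) (neg_one_sq (R := ZMod 3))
    one_ne_zero (show 6 ≠ 0 by norm_num) m
  rw [expand_one_apply] at h
  rw [h]
  refine Finset.sum_eq_zero fun p hp => ?_
  rw [mem_diagReps one_ne_zero (by norm_num)] at hp
  exact absurd (by simpa using hp) (hm p.1 p.2)

theorem four_pow_mul_ne_sq_add_six_mul_sq {k : ℕ} (hk : k % 8 = 3 ∨ k % 8 = 5) (α : ℕ) (x y : ℤ) :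
    ((2 ^ (2 * α) * k : ℕ) : ℤ) ≠ x ^ 2 + 6 * y ^ 2 := by
  induction α generalizing x y with
  | zero =>
    intro h
    have h8 : (k : ZMod 8) = x ^ 2 + 6 * y ^ 2 := by
      rw [mul_zero, pow_zero, one_mul] at h
      exact_mod_cast congrArg (Int.cast : ℤ → ZMod 8) h
    have key : ∀ u v : ZMod 8, u ^ 2 + 6 * v ^ 2 ≠ 3 ∧ u ^ 2 + 6 * v ^ 2 ≠ 5 := by decide
    rw [← ZMod.natCast_mod] at h8
    rcases hk with hk | hk
    · exact (key x y).1 (by rw [← h8, hk]; rfl)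
    · exact (key x y).2 (by rw [← h8, hk]; rfl)
  | succ α ih =>
    intro h
    obtain ⟨u, rfl | rfl⟩ := Int.even_or_odd' x
    · obtain ⟨v, rfl | rfl⟩ := Int.even_or_odd' y
      · apply ih u v
        push_cast at h ⊢
        rw [show 2 * (α + 1) = 2 * α + 2 by ring, pow_add] at h
        linarith
      -- With `x` even and `y` odd the right side is 2 mod 4, while the left side is divisible by 4.
      · push_cast at h
        rw [show 2 * (α + 1) = 2 * α + 2 by ring, pow_add] at h
        ring_nf at h
        omega
    · push_cast at h
      rw [show 2 * (α + 1) = 2 * α + 2 by ring, pow_add] at h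
      ring_nf at h
      omega

theorem corollary1 (n α : ℕ) :
    overpartitionOdd (2 ^ (2 * α) * (24 * n + 9)) ≡ 0 [MOD 3] ∧
      overpartitionOdd (2 ^ (2 * α) * (24 * n + 15)) ≡ 0 [MOD 3] := by
  constructor
  · rw [show 2 ^ (2 * α) * (24 * n + 9) = 3 * (2 ^ (2 * α) * (8 * n + 3)) by ring]
    exact three_dvd_overpartitionOdd_three_mul
      (four_pow_mul_ne_sq_add_six_mul_sq (Or.inl (by omega)) α)
  · rw [show 2 ^ (2 * α) * (24 * n + 15) = 3 * (2 ^ (2 * α) * (8 * n + 5)) by ring]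
    exact three_dvd_overpartitionOdd_three_mul
      (four_pow_mul_ne_sq_add_six_mul_sq (Or.inr (by omega)) α)
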